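/- Let $m\in\mathbb{N}$. For $j=1,2$ let $A_j=\{A_j(k)\}_{k\in\mathbb{Z}}$ and $B_j=\{B_j(k)\}_{k\in\mathbb{Z}}$ be sequences of self-adjoint $m\times m$ complex matrices with $A_j(k)>0$ for all $k$ and $\sup_{k}\big(\|A_j(k)\|+\|B_j(k)\|\big)<\infty$. Let $H_j$ be the bounded self-adjoint matrix-valued Jacobi operator in $\ell^2(\mathbb{Z})^m$ given by $$(H_jf)(k)=A_j(k)f(k+1)+A_j(k-1)f(k-1)+B_j(k)f(k),\qquad k\in\mathbb{Z}.$$ Let $G_j(z,k,\ell)=(H_j-z)^{-1}(k,\ell)\in\mathbb{C}^{m\times m}$ ($z\in\mathbb{C}\setminus\mathbb{R}$, $k,\ell\in\mathbb{Z}$) be its Green's matrix, and $g_j(z,k)=G_j(z,k,k)$. Let $k_0\in\mathbb{Z}$, $0<\varepsilon<\pi$, and let $N\ge 2$ be an integer. Suppose that at least one of the following three conditions holds, where all estimates are understood as $|z|\to\infty$ along the ray $\arg(z)=\pi-\varepsilon$: (i) $\|g_1(z,k_0)-g_2(z,k_0)\|+\|G_1(z,k_0,k_0+1)-G_2(z,k_0,k_0+1)\|=O(|z|^{-(N+2)})$;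 (ii) $\|g_1(z,k_0)-g_2(z,k_0)\|+\|G_1(z,k_0,k_0+1)-G_2(z,k_0,k_0+1)+G_1(z,k_0+1,k_0)-G_2(z,k_0+1,k_0)\|=O(|z|^{-(N+2)})$; (iii) $A_1(k_0)=A_2(k_0)$, $\|g_1(z,k_0)-g_2(z,k_0)\|=O(|z|^{-(N+2)})$ and $\|g_1(z,k_0+1)-g_2(z,k_0+1)\|=O(|z|^{-N})$. Then $$A_1(k_0\pm k)=A_2(k_0\pm k),\quad k=0,\dots,\lfloor N/2\rfloor-1,\qquad B_1(k_0\pm k)=B_2(k_0\pm k),\quad k=0,\dots,\lfloor (N-1)/2\rfloor.$$ -/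

import Mathlib

open scoped Matrix.Norms.L2Operator ComplexOrder

/-- The Hilbert space `ℓ²(ℤ)^m` of square-summable sequences `ℤ → ℂ^m`. -/
abbrev EllTwo (m : ℕ) : Type := lp (fun _ : ℤ => EuclideanSpace ℂ (Fin m)) 2

/-- The coefficients of a bounded matrix-valued Jacobi operator: positive definite `A k`,
self-adjoint `B k`, uniformly bounded in `k`.  The norm on matrices is the operator norm induced by
the Euclidean norm on `ℂ^m`. -/
structure JacobiCoeff (m : ℕ) where
  A : ℤ → Matrix (Fin m) (Fin m) ℂ
  B : ℤ → Matrix (Fin m) (Fin m) ℂ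
  posDef_A : ∀ k, (A k).PosDef
  isHermitian_B : ∀ k, (B k).IsHermitian
  bounded : ∃ C : ℝ, 0 < C ∧ ∀ k, ‖A k‖ + ‖B k‖ ≤ C

theorem norm_toEuclideanCLM_apply_le {m : ℕ} {C : ℝ} (T : Matrix (Fin m) (Fin m) ℂ)
    (hT : ‖T‖ ≤ C) (x : EuclideanSpace ℂ (Fin m)) :
    ‖Matrix.toEuclideanCLM (𝕜 := ℂ) T x‖ ≤ C * ‖x‖ :=
  ((Matrix.toEuclideanCLM (𝕜 := ℂ) T).le_opNorm x).trans
    (mul_le_mul_of_nonneg_right hT (norm_nonneg x))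

theorem rpow_norm_toEuclideanCLM_apply_le {m : ℕ} {C : ℝ} (T : Matrix (Fin m) (Fin m) ℂ)
    (hT : ‖T‖ ≤ C) (x : EuclideanSpace ℂ (Fin m)) :
    ‖Matrix.toEuclideanCLM (𝕜 := ℂ) T x‖ ^ (2 : ENNReal).toReal ≤
      C ^ (2 : ENNReal).toReal * ‖x‖ ^ (2 : ENNReal).toReal := by
  rw [← Real.mul_rpow ((norm_nonneg T).trans hT) (norm_nonneg x)]
  exact Real.rpow_le_rpow (norm_nonneg _) (norm_toEuclideanCLM_apply_le T hT x) (by norm_num)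

theorem summable_rpow_norm_shift {m : ℕ} (d : ℤ) (f : EllTwo m) :
    Summable fun k : ℤ => ‖f (k + d)‖ ^ (2 : ENNReal).toReal :=
  ((Equiv.addRight d).summable_iff
    (f := fun k : ℤ => ‖f k‖ ^ (2 : ENNReal).toReal)).2
    ((lp.memℓp f).summable (by norm_num))

theorem memℓp_weightedShift {m : ℕ} (T : ℤ → Matrix (Fin m) (Fin m) ℂ) {C : ℝ}
    (hT : ∀ k, ‖T k‖ ≤ C) (d : ℤ) (f : EllTwo m) :
    Memℓp (fun k : ℤ => Matrix.toEuclideanCLM (𝕜 := ℂ) (T k) (f (k + d))) 2 :=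
  memℓp_gen <| Summable.of_nonneg_of_le (fun _ => by positivity)
    (fun k => rpow_norm_toEuclideanCLM_apply_le (T k) (hT k) (f (k + d)))
    ((summable_rpow_norm_shift d f).mul_left _)

/-- The bounded operator `(f k)_k ↦ (T k f(k + d))_k` on `ℓ²(ℤ)^m`. -/
noncomputable def weightedShift {m : ℕ} (T : ℤ → Matrix (Fin m) (Fin m) ℂ) {C : ℝ}
    (hT : ∀ k, ‖T k‖ ≤ C) (d : ℤ) : EllTwo m →L[ℂ] EllTwo m :=
  LinearMap.mkContinuous
    { toFun := fun f => ⟨fun k => Matrix.toEuclideanCLM (𝕜 := ℂ) (T k) (f (k + d)),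
        memℓp_weightedShift T hT d f⟩
      map_add' := fun f g => by ext1; funext k; exact map_add _ _ _
      map_smul' := fun c f => by
        ext1; funext k
        exact map_smul (Matrix.toEuclideanCLM (𝕜 := ℂ) (T k)) c (f (k + d)) }
    C
    (fun f => by
      have hC : 0 ≤ C := (norm_nonneg (T 0)).trans (hT 0)
      refine lp.norm_le_of_tsum_le (by norm_num) (by positivity) ?_
      rw [Real.mul_rpow hC (norm_nonneg f), lp.norm_rpow_eq_tsum (by norm_num) f,
        ← (Equiv.addRight d).tsum_eq (fun k : ℤ => ‖f k‖ ^ (2 : ENNReal).toReal), ← tsum_mul_left]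
      exact Summable.tsum_le_tsum
        (fun k => rpow_norm_toEuclideanCLM_apply_le (T k) (hT k) (f (k + d)))
        ((memℓp_weightedShift T hT d f).summable (by norm_num))
        ((summable_rpow_norm_shift d f).mul_left _))

namespace JacobiCoeff

variable {m : ℕ} (J : JacobiCoeff m)

theorem norm_A_le (k : ℤ) : ‖J.A k‖ ≤ J.bounded.choose :=
  (le_add_of_nonneg_right (norm_nonneg _)).trans (J.bounded.choose_spec.2 k)

theorem norm_B_le (k : ℤ) : ‖J.B k‖ ≤ J.bounded.choose :=
  (le_add_of_nonneg_left (norm_nonneg _)).trans (J.bounded.choose_spec.2 k)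

/-- The Jacobi operator `H = A S⁺ + A⁻ S⁻ + B`, everywhere defined on `ℓ²(ℤ)^m`. -/
noncomputable def H : EllTwo m →L[ℂ] EllTwo m :=
  weightedShift J.A J.norm_A_le 1
    + weightedShift (fun k => J.A (k - 1)) (fun k => J.norm_A_le (k - 1)) (-1)
    + weightedShift J.B J.norm_B_le 0

/-- `(H f)(k) = A(k) f(k+1) + A(k-1) f(k-1) + B(k) f(k)`. -/
theorem H_apply (f : EllTwo m) (k : ℤ) :
    J.H f k = Matrix.toEuclideanCLM (𝕜 := ℂ) (J.A k) (f (k + 1))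
      + Matrix.toEuclideanCLM (𝕜 := ℂ) (J.A (k - 1)) (f (k - 1))
      + Matrix.toEuclideanCLM (𝕜 := ℂ) (J.B k) (f k) := by
  have h : J.H f k = Matrix.toEuclideanCLM (𝕜 := ℂ) (J.A k) (f (k + 1))
      + Matrix.toEuclideanCLM (𝕜 := ℂ) (J.A (k - 1)) (f (k + -1))
      + Matrix.toEuclideanCLM (𝕜 := ℂ) (J.B k) (f (k + 0)) := rfl
  simpa [← sub_eq_add_neg] using h

/-- The Green's matrix `G(z,k,ℓ) = (H - z)⁻¹(k,ℓ)`: the `m × m` block at position `(k,ℓ)` of the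
inverse of `H - z` in the algebra of bounded operators on `ℓ²(ℤ)^m`; its column `j` is the value at
the site `k` of `(H - z)⁻¹` applied to the `j`-th unit vector placed at the site `ℓ`. -/
noncomputable def G (z : ℂ) (k l : ℤ) : Matrix (Fin m) (Fin m) ℂ :=
  Matrix.of fun i j =>
    (Ring.inverse (J.H - z • (1 : EllTwo m →L[ℂ] EllTwo m))
      (lp.single 2 l (EuclideanSpace.single j (1 : ℂ))) : EllTwo m) k i

/-- The diagonal Green's matrix `g(z,k) = G(z,k,k)`. -/
noncomputable def g (z : ℂ) (k : ℤ) : Matrix (Fin m) (Fin m) ℂ := J.G z k k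

end JacobiCoeff

/-- The filter `|z| → ∞` along the ray `arg z = π - ε`. -/
noncomputable def rayAtInfinity (ε : ℝ) : Filter ℂ :=
  Bornology.cobounded ℂ ⊓ Filter.principal {z : ℂ | z.arg = Real.pi - ε}

/-!
As `z → ∞`, `-G(z, k, l)` has the asymptotic expansion `∑ z⁻¹ ^ (n + 1) (H ^ n)(k, l)`, so the decay
of a difference of Green's matrices says that the moments `(H ^ n)(k, l)` of the two operators agree
up to some order. Write the coefficients in the interlaced order `…, B 0, A 0, B 1, A 1, …`. As a
sum over lattice paths, a moment involves only coefficients in an interval of length proportional to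
its order, and an extreme coefficient enters only through the path which goes straight to it and
comes straight back. If the coefficients in the interior of the interval are known, this determines
the extreme one, because the product of the `A`s along the path is invertible, and because positive
definite matrices are determined by their squares.

Starting from `k₀`, one more coefficient on the right is recovered from the additional data
(`G(z, k₀, k₀ + 1)` or `g(z, k₀ + 1)`), and then one more on the left from `g(z, k₀)`. In case (ii)
the contribution of the extreme coefficient takes the form `A Y + Y A` with `A = A(k₀)`; this
vanishes only for `Y = 0`, since `A` is positive definite. Case (i) reduces to (ii) because the
moments `(H ^ n)(k, l)` and `(H ^ n)(l, k)` are adjoint to each other.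
-/

section Moments

variable {R : Type*} [Semiring R]

/-- The `(k, l)` entry of the `n`-th power of the tridiagonal matrix on `ℤ × ℤ` whose `(k, k')`
entry is `c (k + k')` for `|k - k'| ≤ 1`. Indexing the entries by `k + k'` puts the diagonal entries
at the even and the off-diagonal entries at the odd integers, so that moments of order `n` involve
only the coefficients with index in the interval `(k + l - n, k + l + n)`. -/
noncomputable def jacobiMoment (c : ℤ → R) : ℕ → ℤ → ℤ → R
  | 0, k, l => if k = l then 1 else 0
  | n + 1, k, l => ∑ k' ∈ Finset.Icc (k - 1) (k + 1), c (k + k') * jacobiMoment c n k' l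

variable {c c₁ c₂ : ℤ → R} {n : ℕ} {k l : ℤ}

theorem jacobiMoment_zero (c : ℤ → R) (k l : ℤ) :
    jacobiMoment c 0 k l = if k = l then 1 else 0 := rfl

theorem jacobiMoment_succ (c : ℤ → R) (n : ℕ) (k l : ℤ) :
    jacobiMoment c (n + 1) k l =
      ∑ k' ∈ Finset.Icc (k - 1) (k + 1), c (k + k') * jacobiMoment c n k' l := rfl

theorem sum_Icc_sub_one_add_one {M : Type*} [AddCommMonoid M] (f : ℤ → M) (k : ℤ) :
    ∑ k' ∈ Finset.Icc (k - 1) (k + 1), f k' = f (k + 1) + f (k - 1) + f k := by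
  have h : Finset.Icc (k - 1) (k + 1) = {k + 1, k - 1, k} := by
    ext j
    simp only [Finset.mem_Icc, Finset.mem_insert, Finset.mem_singleton]
    lia
  rw [h, Finset.sum_insert (by grind), Finset.sum_insert (by grind), Finset.sum_singleton,
    add_assoc]

theorem jacobiMoment_succ_eq_add (c : ℤ → R) (n : ℕ) (k l : ℤ) :
    jacobiMoment c (n + 1) k l = c (2 * k + 1) * jacobiMoment c n (k + 1) l
      + c (2 * k - 1) * jacobiMoment c n (k - 1) l + c (2 * k) * jacobiMoment c n k l := by
  rw [jacobiMoment_succ, sum_Icc_sub_one_add_one, ← add_assoc, ← add_sub_assoc, two_mul]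

theorem jacobiMoment_one (c : ℤ → R) (h : |k - l| ≤ 1) : jacobiMoment c 1 k l = c (k + l) := by
  simp only [jacobiMoment_succ, jacobiMoment_zero, mul_ite, mul_one, mul_zero,
    Finset.sum_ite_eq']
  exact if_pos (by grind)

theorem jacobiMoment_two_self (c : ℤ → R) (k : ℤ) :
    jacobiMoment c 2 k k = c (2 * k + 1) * c (2 * k + 1)
      + c (2 * k - 1) * c (2 * k - 1) + c (2 * k) * c (2 * k) := by
  rw [jacobiMoment_succ_eq_add, jacobiMoment_one c (by grind), jacobiMoment_one c (by grind),
    jacobiMoment_one c (by grind), add_right_comm k, sub_add_eq_add_sub, ← two_mul]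

theorem jacobiMoment_succ_right (c : ℤ → R) (n : ℕ) (k l : ℤ) :
    jacobiMoment c (n + 1) k l =
      ∑ l' ∈ Finset.Icc (l - 1) (l + 1), jacobiMoment c n k l' * c (l' + l) := by
  induction n generalizing k with
  | zero =>
    simp only [jacobiMoment_succ, jacobiMoment_zero, mul_ite, mul_one, mul_zero, ite_mul, one_mul,
      zero_mul, Finset.sum_ite_eq, Finset.sum_ite_eq']
    congr 1
    simp only [Finset.mem_Icc, eq_iff_iff]
    lia
  | succ n ih =>
    rw [jacobiMoment_succ]
    simp only [ih, jacobiMoment_succ c n, Finset.mul_sum, Finset.sum_mul, mul_assoc]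
    exact Finset.sum_comm

theorem star_jacobiMoment [StarRing R] (c : ℤ → R) (n : ℕ) (k l : ℤ) :
    star (jacobiMoment c n k l) = jacobiMoment (fun i => star (c i)) n l k := by
  induction n generalizing l with
  | zero => simp only [jacobiMoment_zero, eq_comm (a := l), apply_ite star, star_one, star_zero]
  | succ n ih =>
    rw [jacobiMoment_succ_right, jacobiMoment_succ, star_sum]
    simp only [star_mul, ih, add_comm]

theorem jacobiMoment_reflect (c : ℤ → R) (p : ℤ) (n : ℕ) (k l : ℤ) :
    jacobiMoment (fun i => c (2 * p - i)) n k l = jacobiMoment c n (p - k) (p - l) := by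
  induction n generalizing k with
  | zero => simp only [jacobiMoment_zero, sub_right_inj]
  | succ n ih =>
    simp only [jacobiMoment_succ, ih]
    refine Finset.sum_nbij' (p - ·) (p - ·) ?_ ?_ (fun k' _ => sub_sub_cancel p k')
      (fun k' _ => sub_sub_cancel p k') (fun k' _ => ?_)
    · grind
    · grind
    · rw [show 2 * p - (k + k') = p - k + (p - k') by ring]

theorem jacobiMoment_eq_zero_of_lt (c : ℤ → R) (h : (n : ℤ) < |k - l|) :
    jacobiMoment c n k l = 0 := by
  induction n generalizing k with
  | zero => exact if_neg fun hkl => by simp [hkl] at h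
  | succ n ih =>
    refine Finset.sum_eq_zero fun k' hk' => ?_
    rw [ih (by grind), mul_zero]

theorem mul_jacobiMoment_congr {j : ℤ} (hc : |k - l| ≤ n → c₁ j = c₂ j) :
    c₁ j * jacobiMoment c n k l = c₂ j * jacobiMoment c n k l := by
  rcases le_or_gt |k - l| (n : ℤ) with h | h
  · rw [hc h]
  · rw [jacobiMoment_eq_zero_of_lt c h, mul_zero, mul_zero]

theorem jacobiMoment_congr (h : Set.EqOn c₁ c₂ (Set.Ioo (k + l - n) (k + l + n))) :
    jacobiMoment c₁ n k l = jacobiMoment c₂ n k l := by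
  induction n generalizing k with
  | zero => rfl
  | succ n ih =>
    refine Finset.sum_congr rfl fun k' hk' => ?_
    rw [ih (h.mono fun i hi => by grind)]
    exact mul_jacobiMoment_congr fun hk => h (by grind)

theorem jacobiMoment_succ_of_add_eq (c : ℤ → R) (h : k + 1 + n = l) :
    jacobiMoment c (n + 1) k l = c (2 * k + 1) * jacobiMoment c n (k + 1) l := by
  rw [jacobiMoment_succ_eq_add, jacobiMoment_eq_zero_of_lt c (k := k - 1) (by grind),
    jacobiMoment_eq_zero_of_lt c (k := k) (by grind), mul_zero, mul_zero, add_zero, add_zero]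

theorem jacobiMoment_succ_of_eq_add (c : ℤ → R) (h : l + 1 + n = k) :
    jacobiMoment c (n + 1) k l = jacobiMoment c n k (l + 1) * c (2 * l + 1) := by
  rw [jacobiMoment_succ_right, sum_Icc_sub_one_add_one,
    jacobiMoment_eq_zero_of_lt c (l := l - 1) (by grind),
    jacobiMoment_eq_zero_of_lt c (l := l) (by grind), zero_mul, zero_mul, add_zero, add_zero,
    two_mul, add_right_comm]

theorem isUnit_jacobiMoment_of_add_eq (hc : ∀ k, IsUnit (c (2 * k + 1))) (h : k + n = l) :
    IsUnit (jacobiMoment c n k l) := by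
  induction n generalizing k with
  | zero =>
    obtain rfl : k = l := by simpa using h
    rw [jacobiMoment_zero, if_pos rfl]
    exact isUnit_one
  | succ n ih =>
    rw [jacobiMoment_succ_of_add_eq c (by grind)]
    exact (hc k).mul (ih (by grind))

theorem isUnit_jacobiMoment_of_eq_add [StarRing R] (hc : ∀ k, IsUnit (c (2 * k + 1)))
    (h : l + n = k) : IsUnit (jacobiMoment c n k l) := by
  rw [← isUnit_star, star_jacobiMoment]
  exact isUnit_jacobiMoment_of_add_eq (fun k => (hc k).star) h

end Moments

section Difference

variable {R : Type*} [Ring R] {c₁ c₂ : ℤ → R} {k l q : ℤ} {a r b : ℕ}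

theorem jacobiMoment_succ_sub_eq_mul {n : ℕ} (hkl : k + 1 < l + n)
    (h : Set.EqOn c₁ c₂ (Set.Ioo (k + l - (n + 1)) (k + l + n))) :
    jacobiMoment c₁ (n + 1) k l - jacobiMoment c₂ (n + 1) k l =
      c₁ (2 * k + 1) * (jacobiMoment c₁ n (k + 1) l - jacobiMoment c₂ n (k + 1) l) := by
  have hdown : c₁ (2 * k - 1) * jacobiMoment c₁ n (k - 1) l
      = c₂ (2 * k - 1) * jacobiMoment c₂ n (k - 1) l := by
    rw [jacobiMoment_congr (c₁ := c₁) (c₂ := c₂) (h.mono fun i hi => by grind)]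
    exact mul_jacobiMoment_congr fun hk => h (by grind)
  have hstay : c₁ (2 * k) * jacobiMoment c₁ n k l = c₂ (2 * k) * jacobiMoment c₂ n k l := by
    rw [jacobiMoment_congr (c₁ := c₁) (c₂ := c₂) (h.mono fun i hi => by grind)]
    exact mul_jacobiMoment_congr fun hk => h (by grind)
  have hup : c₁ (2 * k + 1) * jacobiMoment c₂ n (k + 1) l
      = c₂ (2 * k + 1) * jacobiMoment c₂ n (k + 1) l :=
    mul_jacobiMoment_congr fun hk => h (by grind)
  rw [jacobiMoment_succ_eq_add, jacobiMoment_succ_eq_add, hdown, hstay, mul_sub, hup]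
  abel

theorem jacobiMoment_sub_eq_mul (hk : k + a = q) (hq : q < l + r)
    (h : Set.EqOn c₁ c₂ (Set.Ioo (k + l - (a + r)) (k + l + (a + r) - 1))) :
    jacobiMoment c₁ (a + r) k l - jacobiMoment c₂ (a + r) k l =
      jacobiMoment c₁ a k q * (jacobiMoment c₁ r q l - jacobiMoment c₂ r q l) := by
  induction a generalizing k with
  | zero =>
    obtain rfl : k = q := by simpa using hk
    rw [jacobiMoment_zero, if_pos rfl, one_mul, zero_add]
  | succ a ih =>
    push_cast at h hk
    rw [Nat.succ_add, jacobiMoment_succ_sub_eq_mul (by grind) (h.mono fun i hi => by grind),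
      ih (by grind) (h.mono fun i hi => by grind), jacobiMoment_succ_of_add_eq c₁ (by grind),
      mul_assoc]

/-- When `c₁` and `c₂` may differ only at the last index `2 * q + r - 1` in range, the only paths
that matter climb straight from `k` to `q`, make `r` steps there and descend straight to `l`. -/
theorem jacobiMoment_sub_eq_mul_mul [StarRing R] (hk : k + a = q) (hl : l + b = q)
    (hr : 0 < r) (h : Set.EqOn c₁ c₂ (Set.Ioo (k + l - (a + r + b)) (k + l + (a + r + b) - 1))) :
    jacobiMoment c₁ (a + r + b) k l - jacobiMoment c₂ (a + r + b) k l =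
      jacobiMoment c₁ a k q * (jacobiMoment c₁ r q q - jacobiMoment c₂ r q q)
        * jacobiMoment c₁ b q l := by
  have hright : jacobiMoment c₁ (b + r) q l - jacobiMoment c₂ (b + r) q l
      = (jacobiMoment c₁ r q q - jacobiMoment c₂ r q q) * jacobiMoment c₁ b q l := by
    rw [← star_inj]
    simp only [star_sub, star_mul, star_jacobiMoment]
    exact jacobiMoment_sub_eq_mul hl (by grind) fun i hi => congrArg star (h (by grind))
  rw [mul_assoc, ← hright, add_assoc, add_comm r b]
  exact jacobiMoment_sub_eq_mul hk (by grind) (h.mono fun i hi => by grind)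

end Difference

section Determination

open Matrix

variable {𝕜 ι : Type*} [RCLike 𝕜] [Fintype ι]

theorem eq_zero_of_posDef_mul_add_mul_posSemidef {A A' X : Matrix ι ι 𝕜} (hA : A.PosDef)
    (hA' : A'.PosSemidef) (h : A * X + X * A' = 0) : X = 0 := by
  have hleft : (Xᴴ * A * X).PosSemidef := hA.posSemidef.conjTranspose_mul_mul_same X
  have hright : (X * A' * Xᴴ).PosSemidef := hA'.mul_mul_conjTranspose_same X
  have htrace : (Xᴴ * A * X).trace + (X * A' * Xᴴ).trace = 0 := by
    rw [trace_mul_comm (X * A'), mul_assoc, ← trace_add, ← mul_add, h, mul_zero, trace_zero]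
  have hzero : Xᴴ * A * X = 0 := hleft.trace_eq_zero_iff.1
    ((add_eq_zero_iff_of_nonneg hleft.trace_nonneg hright.trace_nonneg).1 htrace).1
  refine ext_iff_mulVec.2 fun v => ?_
  rw [zero_mulVec]
  by_contra hv
  have hpos := hA.dotProduct_mulVec_pos hv
  rw [star_mulVec, ← dotProduct_mulVec, mulVec_mulVec, mulVec_mulVec, hzero] at hpos
  simp at hpos

theorem eq_of_mul_self_eq_of_posDef {A A' : Matrix ι ι 𝕜} (hA : A.PosDef) (hA' : A'.PosSemidef)
    (h : A * A = A' * A') : A = A' := by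
  refine sub_eq_zero.1 (eq_zero_of_posDef_mul_add_mul_posSemidef hA hA' ?_)
  rw [mul_sub, sub_mul, h, sub_add_sub_cancel, sub_self]

variable [DecidableEq ι] {c c₁ c₂ : ℤ → Matrix ι ι 𝕜}

theorem coeff_eq_of_jacobiMoment_self_eq (hc₁ : ∀ k, (c₁ (2 * k + 1)).PosDef)
    (hc₂ : ∀ k, (c₂ (2 * k + 1)).PosDef) {q : ℤ} {r : ℕ} (hr : r = 1 ∨ r = 2)
    (h : Set.EqOn c₁ c₂ (Set.Ioo (2 * q - r) (2 * q + r - 1)))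
    (hM : jacobiMoment c₁ r q q = jacobiMoment c₂ r q q) :
    c₁ (2 * q + r - 1) = c₂ (2 * q + r - 1) := by
  rcases hr with rfl | rfl
  · rwa [jacobiMoment_one _ (by grind), jacobiMoment_one _ (by grind), ← two_mul,
      ← add_sub_cancel_right (2 * q) 1] at hM
  · have hdown : c₁ (2 * q - 1) = c₂ (2 * q - 1) := h (by grind)
    have hstay : c₁ (2 * q) = c₂ (2 * q) := h (by grind)
    have hsq : c₁ (2 * q + 1) * c₁ (2 * q + 1) = c₂ (2 * q + 1) * c₂ (2 * q + 1) := by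
      rwa [jacobiMoment_two_self, jacobiMoment_two_self, hdown, hstay, add_left_inj,
        add_left_inj] at hM
    convert eq_of_mul_self_eq_of_posDef (hc₁ q) (hc₂ q).posSemidef hsq using 2 <;> grind

theorem coeff_eq_of_jacobiMoment_eq (hc₁ : ∀ k, (c₁ (2 * k + 1)).PosDef)
    (hc₂ : ∀ k, (c₂ (2 * k + 1)).PosDef) {k l q : ℤ} {a r b : ℕ} (hk : k + a = q) (hl : l + b = q)
    (hr : r = 1 ∨ r = 2)
    (h : Set.EqOn c₁ c₂ (Set.Ioo (k + l - (a + r + b)) (k + l + (a + r + b) - 1)))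
    (hM : jacobiMoment c₁ (a + r + b) k l = jacobiMoment c₂ (a + r + b) k l) :
    c₁ (2 * q + r - 1) = c₂ (2 * q + r - 1) := by
  have hunit : ∀ k, IsUnit (c₁ (2 * k + 1)) := fun k => (hc₁ k).isUnit
  have hsub := jacobiMoment_sub_eq_mul_mul hk hl (by grind) h
  rw [hM, sub_self, eq_comm,
    (isUnit_jacobiMoment_of_eq_add hunit hl).mul_left_eq_zero,
    (isUnit_jacobiMoment_of_add_eq hunit hk).mul_right_eq_zero, sub_eq_zero] at hsub
  exact coeff_eq_of_jacobiMoment_self_eq hc₁ hc₂ hr (h.mono fun i hi => by grind) hsub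

/-- The coefficient of index `m` is the apex of a path from `q` to itself: for even `m` a single
step that stays at `q`, for odd `m` the two steps from `q` to `q + 1` and back. -/
theorem exists_two_mul_add_sub_one (m : ℤ) :
    ∃ (q : ℤ) (r : ℕ), (r = 1 ∨ r = 2) ∧ m = 2 * q + r - 1 := by
  rcases Int.even_or_odd' m with ⟨q, rfl | rfl⟩
  · exact ⟨q, 1, .inl rfl, by grind⟩
  · exact ⟨q, 2, .inr rfl, by grind⟩

theorem left_coeff_eq_of_jacobiMoment_eq (hc₁ : ∀ k, (c₁ (2 * k + 1)).PosDef)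
    (hc₂ : ∀ k, (c₂ (2 * k + 1)).PosDef) (k : ℤ) (m : ℕ)
    (h : Set.EqOn c₁ c₂ (Set.Ioc (2 * k - m) (2 * k + m)))
    (hM : jacobiMoment c₁ (m + 1) k k = jacobiMoment c₂ (m + 1) k k) :
    c₁ (2 * k - m) = c₂ (2 * k - m) := by
  obtain ⟨q, r, hr, hm⟩ := exists_two_mul_add_sub_one (2 * k + m)
  obtain ⟨a, ha⟩ : ∃ a : ℕ, k + a = q := ⟨(q - k).toNat, by lia⟩
  have hodd : ∀ j, 2 * (2 * k) - (2 * j + 1) = 2 * (2 * k - j - 1) + 1 := fun j => by ring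
  have hmoment := coeff_eq_of_jacobiMoment_eq (c₁ := fun i => c₁ (2 * (2 * k) - i))
    (c₂ := fun i => c₂ (2 * (2 * k) - i)) (fun j => hodd j ▸ hc₁ _) (fun j => hodd j ▸ hc₂ _)
    ha ha hr (fun i hi => h (by grind)) (by
      rwa [jacobiMoment_reflect, jacobiMoment_reflect, two_mul, add_sub_cancel_right,
        show a + r + a = m + 1 by lia])
  rwa [← hm, show 2 * (2 * k) - (2 * k + m) = 2 * k - m by ring] at hmoment

theorem eqOn_of_jacobiMoment_self_eq_of_right (hc₁ : ∀ k, (c₁ (2 * k + 1)).PosDef)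
    (hc₂ : ∀ k, (c₂ (2 * k + 1)).PosDef) (k : ℤ) (N : ℕ)
    (hM : ∀ n ≤ N, jacobiMoment c₁ n k k = jacobiMoment c₂ n k k)
    (hright : ∀ m : ℕ, 0 < m → m < N → Set.EqOn c₁ c₂ (Set.Ioo (2 * k - m) (2 * k + m)) →
      c₁ (2 * k + m) = c₂ (2 * k + m)) :
    Set.EqOn c₁ c₂ (Set.Ioo (2 * k - N) (2 * k + N)) := by
  induction N with
  | zero => exact fun i hi => by grind
  | succ m ih =>
    have hm := ih (fun n hn => hM n (by lia)) (fun n hn hnm => hright n hn (by lia))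
    have hmr : Set.EqOn c₁ c₂ (Set.Ioc (2 * k - m) (2 * k + m)) := fun i hi => by
      rcases hi.2.eq_or_lt with rfl | hlt
      · exact hright m (by grind) (by lia) hm
      · exact hm ⟨hi.1, hlt⟩
    intro i hi
    rcases eq_or_ne i (2 * k - m) with rfl | hne
    · exact left_coeff_eq_of_jacobiMoment_eq hc₁ hc₂ k m hmr (hM (m + 1) le_rfl)
    · exact hmr (by grind)

theorem eqOn_of_jacobiMoment_self_add_one_eq (hc₁ : ∀ k, (c₁ (2 * k + 1)).PosDef)
    (hc₂ : ∀ k, (c₂ (2 * k + 1)).PosDef) (k : ℤ) (N : ℕ)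
    (hedge : c₁ (2 * k + 1) = c₂ (2 * k + 1))
    (hM : ∀ n ≤ N, jacobiMoment c₁ n k k = jacobiMoment c₂ n k k)
    (hM' : ∀ n, n + 1 < N →
      jacobiMoment c₁ n (k + 1) (k + 1) = jacobiMoment c₂ n (k + 1) (k + 1)) :
    Set.EqOn c₁ c₂ (Set.Ioo (2 * k - N) (2 * k + N)) := by
  refine eqOn_of_jacobiMoment_self_eq_of_right hc₁ hc₂ k N hM fun m hm hmN h => ?_
  obtain rfl | hm₂ : m = 1 ∨ 2 ≤ m := by lia
  · exact hedge
  obtain ⟨q, r, hr, hq⟩ := exists_two_mul_add_sub_one (2 * k + m)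
  obtain ⟨a, ha⟩ : ∃ a : ℕ, k + 1 + a = q := ⟨(q - k - 1).toNat, by lia⟩
  rw [hq]
  exact coeff_eq_of_jacobiMoment_eq hc₁ hc₂ ha ha hr (h.mono fun i hi => by grind)
    (hM' _ (by lia))

theorem coeff_eq_of_jacobiMoment_add_jacobiMoment_eq (hc₁ : ∀ k, (c₁ (2 * k + 1)).PosDef)
    (hc₂ : ∀ k, (c₂ (2 * k + 1)).PosDef) {k q : ℤ} {r b : ℕ} (hb : k + 1 + b = q)
    (hr : r = 1 ∨ r = 2)
    (h : Set.EqOn c₁ c₂ (Set.Ioo (2 * k - (2 * b + r)) (2 * q + r - 1)))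
    (hM : jacobiMoment c₁ (b + 1 + r + b) k (k + 1) + jacobiMoment c₁ (b + 1 + r + b) (k + 1) k
      = jacobiMoment c₂ (b + 1 + r + b) k (k + 1) + jacobiMoment c₂ (b + 1 + r + b) (k + 1) k) :
    c₁ (2 * q + r - 1) = c₂ (2 * q + r - 1) := by
  have hb' : k + (b + 1 : ℕ) = q := by grind
  have hunit : ∀ k, IsUnit (c₁ (2 * k + 1)) := fun k => (hc₁ k).isUnit
  set X := jacobiMoment c₁ r q q - jacobiMoment c₂ r q q with hX
  have hup := jacobiMoment_sub_eq_mul_mul (r := r) hb' hb (by grind) (h.mono fun i hi => by grind)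
  have hdown := jacobiMoment_sub_eq_mul_mul (r := r) hb hb' (by grind) (h.mono fun i hi => by grind)
  rw [← hX, jacobiMoment_succ_of_add_eq _ hb] at hup
  rw [← hX, jacobiMoment_succ_of_eq_add _ hb] at hdown
  set Y := jacobiMoment c₁ b (k + 1) q * X * jacobiMoment c₁ b q (k + 1) with hY
  have hsylv : c₁ (2 * k + 1) * Y + Y * c₁ (2 * k + 1) = 0 := by
    have hsum := sub_eq_zero.2 hM
    rw [add_sub_add_comm, hup, show b + 1 + r + b = b + r + (b + 1) by ring, hdown] at hsum
    simpa only [hY, mul_assoc] using hsum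
  have hYzero := eq_zero_of_posDef_mul_add_mul_posSemidef (hc₁ k) (hc₁ k).posSemidef hsylv
  rw [hY, (isUnit_jacobiMoment_of_eq_add hunit hb).mul_left_eq_zero,
    (isUnit_jacobiMoment_of_add_eq hunit hb).mul_right_eq_zero, hX, sub_eq_zero] at hYzero
  exact coeff_eq_of_jacobiMoment_self_eq hc₁ hc₂ hr (h.mono fun i hi => by grind) hYzero

theorem eqOn_of_jacobiMoment_add_jacobiMoment_eq (hc₁ : ∀ k, (c₁ (2 * k + 1)).PosDef)
    (hc₂ : ∀ k, (c₂ (2 * k + 1)).PosDef) (k : ℤ) (N : ℕ)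
    (hM : ∀ n ≤ N, jacobiMoment c₁ n k k = jacobiMoment c₂ n k k)
    (hM' : ∀ n < N, jacobiMoment c₁ n k (k + 1) + jacobiMoment c₁ n (k + 1) k
      = jacobiMoment c₂ n k (k + 1) + jacobiMoment c₂ n (k + 1) k) :
    Set.EqOn c₁ c₂ (Set.Ioo (2 * k - N) (2 * k + N)) := by
  refine eqOn_of_jacobiMoment_self_eq_of_right hc₁ hc₂ k N hM fun m hm hmN h => ?_
  obtain rfl | hm₂ : m = 1 ∨ 2 ≤ m := by lia
  · have hone : ∀ c : ℤ → Matrix ι ι 𝕜, jacobiMoment c 1 k (k + 1) + jacobiMoment c 1 (k + 1) k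
        = (2 : 𝕜) • c (2 * k + 1) := fun c => by
      rw [jacobiMoment_one c (by grind), jacobiMoment_one c (by grind), add_comm (k + 1) k,
        ← add_assoc, ← two_mul k, two_smul]
    exact smul_right_injective _ (two_ne_zero (α := 𝕜))
      (by simpa only [hone, Nat.cast_one] using hM' 1 hmN)
  obtain ⟨q, r, hr, hq⟩ := exists_two_mul_add_sub_one (2 * k + m)
  obtain ⟨b, hb⟩ : ∃ b : ℕ, k + 1 + b = q := ⟨(q - k - 1).toNat, by lia⟩
  obtain rfl : m = b + 1 + r + b := by lia
  rw [hq]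
  exact coeff_eq_of_jacobiMoment_add_jacobiMoment_eq hc₁ hc₂ hb hr (h.mono fun i hi => by grind)
    (hM' _ hmN)

theorem eqOn_of_jacobiMoment_succ_eq (hc₁ : ∀ k, (c₁ (2 * k + 1)).PosDef)
    (hc₂ : ∀ k, (c₂ (2 * k + 1)).PosDef) (hsa₁ : ∀ i, (c₁ i).IsHermitian)
    (hsa₂ : ∀ i, (c₂ i).IsHermitian) (k : ℤ) (N : ℕ)
    (hM : ∀ n ≤ N, jacobiMoment c₁ n k k = jacobiMoment c₂ n k k)
    (hM' : ∀ n < N, jacobiMoment c₁ n k (k + 1) = jacobiMoment c₂ n k (k + 1)) :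
    Set.EqOn c₁ c₂ (Set.Ioo (2 * k - N) (2 * k + N)) := by
  have hstar : ∀ {c : ℤ → Matrix ι ι 𝕜}, (∀ i, (c i).IsHermitian) → ∀ n,
      jacobiMoment c n (k + 1) k = star (jacobiMoment c n k (k + 1)) := fun {c} hc n => by
    rw [star_jacobiMoment, funext fun i => (hc i).star_eq]
  refine eqOn_of_jacobiMoment_add_jacobiMoment_eq hc₁ hc₂ k N hM fun n hn => ?_
  rw [hstar hsa₁, hstar hsa₂, hM' n hn]

end Determination

section Resolvent

open Filter Asymptotics Bornology Topology

theorem resolvent_sub_sum_range_eq {𝕜 R : Type*} [Field 𝕜] [Ring R] [Algebra 𝕜 R] {a : R} {z : 𝕜}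
    (hz : z ∈ resolventSet 𝕜 a) (hz₀ : z ≠ 0) (M : ℕ) :
    resolvent a z - ∑ n ∈ Finset.range M, z⁻¹ ^ (n + 1) • a ^ n
      = resolvent a z * (z⁻¹ ^ M • a ^ M) := by
  have hinv : resolvent a z * (algebraMap 𝕜 R z - a) = 1 := Ring.inverse_mul_cancel _ hz
  have hgeom : (algebraMap 𝕜 R z - a) * ∑ n ∈ Finset.range M, z⁻¹ ^ (n + 1) • a ^ n
      = 1 - z⁻¹ ^ M • a ^ M := by
    have hfactor : algebraMap 𝕜 R z - a = z • (1 - z⁻¹ • a) := by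
      rw [smul_sub, smul_inv_smul₀ hz₀, Algebra.algebraMap_eq_smul_one]
    have hterm : ∀ n, z • z⁻¹ ^ (n + 1) • a ^ n = (z⁻¹ • a) ^ n := fun n => by
      rw [smul_pow, pow_succ', mul_smul, smul_inv_smul₀ hz₀]
    rw [hfactor, smul_mul_assoc, ← mul_smul_comm, Finset.smul_sum]
    simp only [hterm]
    rw [mul_neg_geom_sum, smul_pow]
  rw [sub_eq_iff_eq_add, ← sub_eq_iff_eq_add', ← mul_one (resolvent a z), mul_assoc, one_mul,
    ← mul_sub, ← hgeom, ← mul_assoc, hinv, one_mul]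

theorem norm_zpow_isBigO_inv_pow {𝕜 : Type*} [NormedField 𝕜] {l : Filter 𝕜} (hl : l ≤ cobounded 𝕜)
    {e : ℤ} {n : ℕ} (he : e ≤ -n) :
    (fun z => ‖z‖ ^ e) =O[l] fun z : 𝕜 => z⁻¹ ^ n := by
  have hone : ∀ᶠ z : 𝕜 in l, 1 ≤ ‖z‖ :=
    hl (tendsto_norm_cobounded_atTop.eventually_ge_atTop 1)
  refine .of_bound' (hone.mono fun z hz => ?_)
  rw [Real.norm_of_nonneg (by positivity), norm_pow, norm_inv, inv_pow, ← zpow_natCast,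
    ← zpow_neg]
  exact zpow_le_zpow_right₀ hz he

variable {𝕜 : Type*} [NontriviallyNormedField 𝕜] {R : Type*} [NormedRing R] [NormedAlgebra 𝕜 R]
  [CompleteSpace R]

theorem resolvent_sub_sum_range_isBigO (a : R) (M : ℕ) :
    (fun z : 𝕜 => resolvent a z - ∑ n ∈ Finset.range M, z⁻¹ ^ (n + 1) • a ^ n)
      =O[cobounded 𝕜] fun z => z⁻¹ ^ (M + 1) := by
  have hpow : (fun z : 𝕜 => z⁻¹ ^ M • a ^ M) =O[cobounded 𝕜] fun z => z⁻¹ ^ M :=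
    .of_bound ‖a ^ M‖ (.of_forall fun z => by rw [norm_smul, mul_comm])
  refine ((spectrum.resolvent_isBigO_inv a).mul hpow).congr' ?_
    (.of_forall fun z => (pow_succ' _ _).symm)
  filter_upwards [spectrum.eventually_isUnit_resolvent (𝕜 := 𝕜) a, eventually_ne_cobounded 0]
    with z hz hz₀
  exact (resolvent_sub_sum_range_eq (spectrum.isUnit_resolvent.2 hz) hz₀ M).symm

variable {V : Type*} [NormedAddCommGroup V] [NormedSpace 𝕜 V] {l : Filter 𝕜} [l.NeBot]

theorem eq_zero_of_inv_pow_smul_isBigO (hl : l ≤ cobounded 𝕜) {n : ℕ} {v : V}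
    (h : (fun z => z⁻¹ ^ n • v) =O[l] fun z => z⁻¹ ^ (n + 1)) : v = 0 := by
  have hne : ∀ᶠ z in l, z ≠ 0 := hl (eventually_ne_cobounded 0)
  have hv : (fun _ => v) =O[l] fun z => z⁻¹ := by
    refine ((isBigO_refl (fun z : 𝕜 => z ^ n) l).smul h).congr' ?_ ?_ <;>
      filter_upwards [hne] with z hz
    · rw [smul_smul, ← mul_pow, mul_inv_cancel₀ hz, one_pow, one_smul]
    · rw [smul_eq_mul, pow_succ, ← mul_assoc, ← mul_pow, mul_inv_cancel₀ hz, one_pow, one_mul]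
  exact tendsto_nhds_unique tendsto_const_nhds
    (hv.trans_tendsto ((tendsto_inv₀_cobounded (α := 𝕜)).mono_left hl))

theorem map_pow_eq_of_map_resolvent_sub_isBigO (hl : l ≤ cobounded 𝕜) {a b : R}
    (L : R →L[𝕜] V) {e : ℤ}
    (h : (fun z => L (resolvent a z) - L (resolvent b z)) =O[l] fun z => ‖z‖ ^ e)
    {n : ℕ} (hn : e < -(n + 1)) : L (a ^ n) = L (b ^ n) := by
  induction n using Nat.strong_induction_on with
  | _ n ih =>
  have hremainder : ∀ c : R, (fun z => L (resolvent c z)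
      - ∑ j ∈ Finset.range (n + 1), z⁻¹ ^ (j + 1) • L (c ^ j)) =O[l] fun z => z⁻¹ ^ (n + 2) :=
    fun c => ((L.isBigO_comp _ _).trans
      ((resolvent_sub_sum_range_isBigO c (n + 1)).mono hl)).congr_left fun z => by
        simp only [map_sub, map_sum, map_smul]
  have hlower : ∀ z : 𝕜, ∑ j ∈ Finset.range n, z⁻¹ ^ (j + 1) • L (a ^ j)
      = ∑ j ∈ Finset.range n, z⁻¹ ^ (j + 1) • L (b ^ j) := fun z =>
    Finset.sum_congr rfl fun j hj => by
      have hjn := Finset.mem_range.1 hj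
      rw [ih j hjn (by lia)]
  have hterm : (fun z => z⁻¹ ^ (n + 1) • (L (a ^ n) - L (b ^ n))) =O[l]
      fun z => z⁻¹ ^ (n + 1 + 1) := by
    refine ((h.trans (norm_zpow_isBigO_inv_pow hl (by grind))).sub
      ((hremainder a).sub (hremainder b))).congr_left fun z => ?_
    rw [Finset.sum_range_succ, Finset.sum_range_succ, hlower, smul_sub]
    abel
  exact sub_eq_zero.1 (eq_zero_of_inv_pow_smul_isBigO hl hterm)

end Resolvent

section Operator

open Filter Asymptotics Bornology

theorem isBigO_and_isBigO_of_norm_add_norm {α E F G : Type*} [SeminormedAddCommGroup E]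
    [SeminormedAddCommGroup F] [Norm G] {l : Filter α} {u : α → E} {v : α → F} {f : α → G}
    (h : (fun x => ‖u x‖ + ‖v x‖) =O[l] f) : u =O[l] f ∧ v =O[l] f :=
  ⟨(IsBigO.of_norm_le fun _ => le_add_of_nonneg_right (norm_nonneg _)).trans h,
    (IsBigO.of_norm_le fun _ => le_add_of_nonneg_left (norm_nonneg _)).trans h⟩

theorem ringInverse_neg {R : Type*} [Ring R] (a : R) : Ring.inverse (-a) = -Ring.inverse a := by
  by_cases ha : IsUnit a
  · obtain ⟨u, rfl⟩ := ha
    rw [← Units.val_neg, Ring.inverse_unit, Ring.inverse_unit, ← Units.val_neg, inv_neg]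
  · rw [Ring.inverse_non_unit _ ha, Ring.inverse_non_unit _ (by rwa [IsUnit.neg_iff]), neg_zero]

/-- The block at position `(k, l)` of an operator on `ℓ²(ℤ)^m`. -/
noncomputable def blockEntry {m : ℕ} (k l : ℤ) :
    (EllTwo m →L[ℂ] EllTwo m) →L[ℂ] Matrix (Fin m) (Fin m) ℂ where
  toFun T := Matrix.of fun i j =>
    (T (lp.single 2 l (EuclideanSpace.single j (1 : ℂ))) : EllTwo m) k i
  map_add' _ _ := rfl
  map_smul' _ _ := rfl
  cont := by
    refine continuous_matrix fun i j => ?_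
    exact (EuclideanSpace.proj i).continuous.comp <| (lp.evalCLM ℂ _ 2 k).continuous.comp <|
      continuous_eval_const (lp.single 2 l (EuclideanSpace.single j (1 : ℂ)) : EllTwo m)

theorem blockEntry_one {m : ℕ} (k l : ℤ) :
    blockEntry k l (1 : EllTwo m →L[ℂ] EllTwo m) = if k = l then 1 else 0 := by
  ext i j
  change (lp.single 2 l (EuclideanSpace.single j (1 : ℂ)) : EllTwo m) k i = _
  rcases eq_or_ne k l with rfl | h
  · simp [Matrix.one_apply]
  · simp [h]

namespace JacobiCoeff

variable {m : ℕ}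

/-- The coefficients of a Jacobi operator in the interlaced order `…, B 0, A 0, B 1, A 1, …`, so
that the block `(k, k')` of the operator is `coeff (k + k')` whenever `|k - k'| ≤ 1`. -/
def coeff (J : JacobiCoeff m) (i : ℤ) : Matrix (Fin m) (Fin m) ℂ :=
  if Even i then J.B (i / 2) else J.A (i / 2)

theorem coeff_two_mul (J : JacobiCoeff m) (k : ℤ) : J.coeff (2 * k) = J.B k := by
  rw [coeff, if_pos (even_two_mul k), Int.mul_ediv_cancel_left k two_ne_zero]

theorem coeff_two_mul_add_one (J : JacobiCoeff m) (k : ℤ) : J.coeff (2 * k + 1) = J.A k := by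
  rw [coeff, if_neg (by grind), show (2 * k + 1) / 2 = k by lia]

theorem posDef_coeff (J : JacobiCoeff m) (k : ℤ) : (J.coeff (2 * k + 1)).PosDef :=
  J.coeff_two_mul_add_one k ▸ J.posDef_A k

theorem isHermitian_coeff (J : JacobiCoeff m) (i : ℤ) : (J.coeff i).IsHermitian := by
  rw [coeff]
  split_ifs
  · exact J.isHermitian_B _
  · exact (J.posDef_A _).isHermitian

theorem blockEntry_H_mul (J : JacobiCoeff m) (T : EllTwo m →L[ℂ] EllTwo m) (k l : ℤ) :
    blockEntry k l (J.H * T) = J.A k * blockEntry (k + 1) l T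
      + J.A (k - 1) * blockEntry (k - 1) l T + J.B k * blockEntry k l T := by
  ext i j
  change (J.H (T (lp.single 2 l (EuclideanSpace.single j (1 : ℂ)))) : EllTwo m) k i = _
  rw [H_apply]
  rfl

theorem blockEntry_H_pow (J : JacobiCoeff m) (n : ℕ) (k l : ℤ) :
    blockEntry k l (J.H ^ n) = jacobiMoment J.coeff n k l := by
  induction n generalizing k with
  | zero => rw [pow_zero, blockEntry_one, jacobiMoment_zero]
  | succ n ih =>
    rw [pow_succ', blockEntry_H_mul, jacobiMoment_succ_eq_add, ih, ih, ih, coeff_two_mul_add_one,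
      coeff_two_mul, show 2 * k - 1 = 2 * (k - 1) + 1 by ring, coeff_two_mul_add_one]

theorem G_eq_neg_blockEntry_resolvent (J : JacobiCoeff m) (z : ℂ) (k l : ℤ) :
    J.G z k l = -blockEntry k l (resolvent J.H z) := by
  rw [← map_neg, resolvent, ← ringInverse_neg, neg_sub, Algebra.algebraMap_eq_smul_one]
  rfl

variable {J₁ J₂ : JacobiCoeff m} {l : Filter ℂ} [l.NeBot] {e : ℤ} {n : ℕ}

theorem jacobiMoment_coeff_eq_of_G_sub_isBigO (hl : l ≤ cobounded ℂ) {k k' : ℤ}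
    (h : (fun z => J₁.G z k k' - J₂.G z k k') =O[l] fun z => ‖z‖ ^ e) (hn : e < -(n + 1)) :
    jacobiMoment J₁.coeff n k k' = jacobiMoment J₂.coeff n k k' := by
  rw [← blockEntry_H_pow, ← blockEntry_H_pow]
  refine map_pow_eq_of_map_resolvent_sub_isBigO hl _ (h.neg_left.congr_left fun z => ?_) hn
  simp only [G_eq_neg_blockEntry_resolvent]
  abel

theorem jacobiMoment_coeff_add_eq_of_G_sub_isBigO (hl : l ≤ cobounded ℂ) {k k' : ℤ}
    (h : (fun z => J₁.G z k k' - J₂.G z k k' + J₁.G z k' k - J₂.G z k' k) =O[l]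
      fun z => ‖z‖ ^ e) (hn : e < -(n + 1)) :
    jacobiMoment J₁.coeff n k k' + jacobiMoment J₁.coeff n k' k
      = jacobiMoment J₂.coeff n k k' + jacobiMoment J₂.coeff n k' k := by
  simp only [← blockEntry_H_pow]
  refine map_pow_eq_of_map_resolvent_sub_isBigO hl (blockEntry k k' + blockEntry k' k)
    (h.neg_left.congr_left fun z => ?_) hn
  simp only [G_eq_neg_blockEntry_resolvent, add_apply]
  abel

end JacobiCoeff

theorem rayAtInfinity_neBot {ε : ℝ} (hε₀ : 0 ≤ ε) (hεπ : ε < 2 * Real.pi) :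
    (rayAtInfinity ε).NeBot := by
  have h : Tendsto (fun r : ℝ => (r : ℂ) * Complex.exp ((Real.pi - ε : ℝ) * Complex.I)) atTop
      (rayAtInfinity ε) := by
    refine tendsto_inf.2 ⟨?_, tendsto_principal.2 ?_⟩
    · rw [← tendsto_norm_atTop_iff_cobounded]
      refine tendsto_abs_atTop_atTop.congr fun r => ?_
      rw [norm_mul, Complex.norm_exp_ofReal_mul_I, mul_one, Complex.norm_real, Real.norm_eq_abs]
    · filter_upwards [eventually_gt_atTop 0] with r hr
      rw [Complex.arg_real_mul _ hr, Complex.arg_exp_mul_I, toIocMod_eq_self]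
      constructor <;> linarith
  exact h.neBot

end Operator

theorem theorem4p6_general {m : ℕ} {l : Filter ℂ} [l.NeBot] (hl : l ≤ Bornology.cobounded ℂ)
    (J₁ J₂ : JacobiCoeff m) (k₀ : ℤ) (N : ℕ)
    (hyp :
      ((fun z : ℂ => ‖J₁.g z k₀ - J₂.g z k₀‖ + ‖J₁.G z k₀ (k₀ + 1) - J₂.G z k₀ (k₀ + 1)‖)
          =O[l] fun z : ℂ => ‖z‖ ^ (-((N : ℤ) + 2)))
      ∨
      ((fun z : ℂ => ‖J₁.g z k₀ - J₂.g z k₀‖ +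
            ‖J₁.G z k₀ (k₀ + 1) - J₂.G z k₀ (k₀ + 1)
              + J₁.G z (k₀ + 1) k₀ - J₂.G z (k₀ + 1) k₀‖)
          =O[l] fun z : ℂ => ‖z‖ ^ (-((N : ℤ) + 2)))
      ∨
      (J₁.A k₀ = J₂.A k₀ ∧
        ((fun z : ℂ => ‖J₁.g z k₀ - J₂.g z k₀‖)
          =O[l] fun z : ℂ => ‖z‖ ^ (-((N : ℤ) + 2))) ∧
        ((fun z : ℂ => ‖J₁.g z (k₀ + 1) - J₂.g z (k₀ + 1)‖)
          =O[l] fun z : ℂ => ‖z‖ ^ (-(N : ℤ))))) :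
    Set.EqOn J₁.A J₂.A (Set.Ico (k₀ - N / 2) (k₀ + N / 2)) ∧
      Set.EqOn J₁.B J₂.B (Set.Ioo (k₀ - (N + 1) / 2) (k₀ + (N + 1) / 2)) := by
  suffices h : Set.EqOn J₁.coeff J₂.coeff (Set.Ioo (2 * k₀ - N) (2 * k₀ + N)) from
    ⟨fun k hk => by
      simpa only [JacobiCoeff.coeff_two_mul_add_one] using h (x := 2 * k + 1) (by grind),
    fun k hk => by simpa only [JacobiCoeff.coeff_two_mul] using h (x := 2 * k) (by grind)⟩
  rcases hyp with hyp | hyp | ⟨hA, hg, hg'⟩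
  · have ⟨hg, hG⟩ := isBigO_and_isBigO_of_norm_add_norm hyp
    exact eqOn_of_jacobiMoment_succ_eq J₁.posDef_coeff J₂.posDef_coeff J₁.isHermitian_coeff
      J₂.isHermitian_coeff k₀ N
      (fun n hn => JacobiCoeff.jacobiMoment_coeff_eq_of_G_sub_isBigO hl hg (by lia))
      (fun n hn => JacobiCoeff.jacobiMoment_coeff_eq_of_G_sub_isBigO hl hG (by lia))
  · have ⟨hg, hG⟩ := isBigO_and_isBigO_of_norm_add_norm hyp
    exact eqOn_of_jacobiMoment_add_jacobiMoment_eq J₁.posDef_coeff J₂.posDef_coeff k₀ N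
      (fun n hn => JacobiCoeff.jacobiMoment_coeff_eq_of_G_sub_isBigO hl hg (by lia))
      (fun n hn => JacobiCoeff.jacobiMoment_coeff_add_eq_of_G_sub_isBigO hl hG (by lia))
  · refine eqOn_of_jacobiMoment_self_add_one_eq J₁.posDef_coeff J₂.posDef_coeff k₀ N
      (by rwa [JacobiCoeff.coeff_two_mul_add_one, JacobiCoeff.coeff_two_mul_add_one])
      (fun n hn => JacobiCoeff.jacobiMoment_coeff_eq_of_G_sub_isBigO hl hg.of_norm_left (by lia))
      (fun n hn => JacobiCoeff.jacobiMoment_coeff_eq_of_G_sub_isBigO hl hg'.of_norm_left (by lia))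

theorem theorem4p6 {m : ℕ} (ε : ℝ) (hε₀ : 0 < ε) (hεπ : ε < Real.pi)
    (J₁ J₂ : JacobiCoeff m) (k₀ : ℤ) (N : ℕ) (hN : 2 ≤ N)
    (hyp :
      -- condition (i)
      ((fun z : ℂ => ‖J₁.g z k₀ - J₂.g z k₀‖ + ‖J₁.G z k₀ (k₀ + 1) - J₂.G z k₀ (k₀ + 1)‖)
          =O[rayAtInfinity ε] fun z : ℂ => ‖z‖ ^ (-((N : ℤ) + 2)))
      ∨
      -- condition (ii)
      ((fun z : ℂ => ‖J₁.g z k₀ - J₂.g z k₀‖ +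
            ‖J₁.G z k₀ (k₀ + 1) - J₂.G z k₀ (k₀ + 1)
              + J₁.G z (k₀ + 1) k₀ - J₂.G z (k₀ + 1) k₀‖)
          =O[rayAtInfinity ε] fun z : ℂ => ‖z‖ ^ (-((N : ℤ) + 2)))
      ∨
      -- condition (iii)
      (J₁.A k₀ = J₂.A k₀ ∧
        ((fun z : ℂ => ‖J₁.g z k₀ - J₂.g z k₀‖)
          =O[rayAtInfinity ε] fun z : ℂ => ‖z‖ ^ (-((N : ℤ) + 2))) ∧
        ((fun z : ℂ => ‖J₁.g z (k₀ + 1) - J₂.g z (k₀ + 1)‖)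
          =O[rayAtInfinity ε] fun z : ℂ => ‖z‖ ^ (-(N : ℤ))))) :
    (∀ k : ℕ, k ≤ N / 2 - 1 →
        J₁.A (k₀ + k) = J₂.A (k₀ + k) ∧ J₁.A (k₀ - k) = J₂.A (k₀ - k)) ∧
    (∀ k : ℕ, k ≤ (N - 1) / 2 →
        J₁.B (k₀ + k) = J₂.B (k₀ + k) ∧ J₁.B (k₀ - k) = J₂.B (k₀ - k)) := by
  have := rayAtInfinity_neBot hε₀.le (by linarith)
  obtain ⟨hA, hB⟩ := theorem4p6_general (l := rayAtInfinity ε) inf_le_left J₁ J₂ k₀ N hyp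
  exact ⟨fun k hk => ⟨hA ⟨by lia, by lia⟩, hA ⟨by lia, by lia⟩⟩,
    fun k hk => ⟨hB ⟨by lia, by lia⟩, hB ⟨by lia, by lia⟩⟩⟩
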